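/- Let $\mathbb{R}^{\mathbb{N}}$ be the set of real sequences $(x_1,x_2,\ldots)$ with its Borel $\sigma$-field $\mathcal{B}(\mathbb{R}^{\mathbb{N}})$, let $T(x_1,x_2,\ldots)=(x_2,x_3,\ldots)$ be the shift, and let $\mathbb{Q}$ be a stationary (that is, $T$-invariant) probability measure on $(\mathbb{R}^{\mathbb{N}},\mathcal{B}(\mathbb{R}^{\mathbb{N}}))$. Let $\mathcal{I}_{\mathbb{Q}}$ be the $\sigma$-field of almost invariant sets, i.e. of all $A\in\mathcal{B}(\mathbb{R}^{\mathbb{N}})$ with $\mathbb{Q}\big((A\setminus T^{-1}A)\cup(T^{-1}A\setminus A)\big)=0$. Let $Y$ be a real random variable on $(\mathbb{R}^{\mathbb{N}},\mathcal{B}(\mathbb{R}^{\mathbb{N}}),\mathbb{Q})$ and put $Y_i=Y\circ T^{i-1}$ for $i\ge 1$. Let $\gamma_1(Y|\mathcal{I}_{\mathbb{Q}})$ be (any version of) the conditional right endpoint of the support of $Y$ given $\mathcal{I}_{\mathbb{Q}}$, i.e. an $\mathcal{I}_{\mathbb{Q}}$-measurable $[-\infty,\infty]$-valued function $\gamma$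 such that $\mathbb{Q}(Y\le\gamma|\mathcal{I}_{\mathbb{Q}})=1$ a.s. and such that $\gamma\le g$ a.s. for every $\mathcal{I}_{\mathbb{Q}}$-measurable $[-\infty,\infty]$-valued $g$ with $\mathbb{Q}(Y\le g|\mathcal{I}_{\mathbb{Q}})=1$ a.s. Let $a>0$ be a real number and let $(k_n)_{n\ge1}$ be integers with $1\le k_n\le n$ for all $n$ and $k_n/n\to1$. Let $Y_{1:n}\le\cdots\le Y_{n:n}$ be the order statistics of $Y_1,\ldots,Y_n$, and let $$K^{\mathbb{Y}}(k_n,n,a)=\sum_{i=1}^n I\big(Y_{k_n:n}-a<Y_i<Y_{k_n:n}\big).$$ If $$\mathbb{Q}\big(Y=\gamma_1(Y|\mathcal{I}_{\mathbb{Q}})\big)=0\quad\text{and}\quad\mathbb{Q}\big(Y=\gamma_1(Y|\mathcal{I}_{\mathbb{Q}})-a\big)=0,$$ then, as $n\to\infty$, $$\frac{K^{\mathbb{Y}}(k_n,n,a)}{n}\longrightarrow\mathbb{Q}\big(Y>\gamma_1(Y|\mathcal{I}_{\mathbb{Q}})-a\,\big|\,\mathcal{I}_{\mathbb{Q}}\big)\qquad\mathbb{Q}\text{-almost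 surely}.$$ -/

import Mathlib

open MeasureTheory ProbabilityTheory Filter Topology

namespace NearMax

/-- The shift `(x₁, x₂, …) ↦ (x₂, x₃, …)` on real sequences; a sequence `(x₁, x₂, …)` is the
function `ℕ → ℝ` with `x_{j+1}` at index `j`. -/
def shift (x : ℕ → ℝ) : ℕ → ℝ := fun j => x (j + 1)

/-- The σ-field of those Borel sets `A` of sequences that are almost invariant for `Q`:
`A` and `T⁻¹A` differ by a `Q`-null set, `T` being the shift. -/
@[reducible]
def almostInvariant (Q : Measure (ℕ → ℝ)) : MeasurableSpace (ℕ → ℝ) where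
  MeasurableSet' A := MeasurableSet A ∧ Q ((A \ shift ⁻¹' A) ∪ (shift ⁻¹' A \ A)) = 0
  measurableSet_empty := by simp
  measurableSet_compl A hA := by
    refine ⟨hA.1.compl, ?_⟩
    convert hA.2 using 2
    ext x
    simp only [Set.mem_union, Set.mem_sdiff, Set.mem_preimage, Set.mem_compl_iff]
    tauto
  measurableSet_iUnion f hf := by
    refine ⟨MeasurableSet.iUnion fun i => (hf i).1, ?_⟩
    refine measure_mono_null ?_ (measure_iUnion_null fun i => (hf i).2)
    intro x hx
    simp only [Set.mem_union, Set.mem_sdiff, Set.mem_preimage, Set.mem_iUnion, not_exists] at hx ⊢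
    rcases hx with ⟨⟨i, hi⟩, h⟩ | ⟨⟨i, hi⟩, h⟩
    · exact ⟨i, Or.inl ⟨hi, h i⟩⟩
    · exact ⟨i, Or.inr ⟨hi, h i⟩⟩

theorem almostInvariant_le (Q : Measure (ℕ → ℝ)) :
    almostInvariant Q ≤ (inferInstance : MeasurableSpace (ℕ → ℝ)) :=
  fun _ hA => hA.1

/-- `γ` is a version of the conditional right endpoint of the support of the random variable `X`
given the sub-σ-field `𝒢`: the a.s. least `𝒢`-measurable extended random variable with
`P(X ≤ γ | 𝒢) = 1` a.s. -/
structure IsCondRightEndpoint {Ω : Type*} {m₀ : MeasurableSpace Ω} (P : Measure Ω) (X : Ω → ℝ)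
    (𝒢 : MeasurableSpace Ω) (γ : Ω → EReal) : Prop where
  sub_field : 𝒢 ≤ m₀
  measurable : Measurable[𝒢] γ
  le_endpoint : P⟦{ω | (X ω : EReal) ≤ γ ω} | 𝒢⟧ =ᵐ[P] fun _ => 1
  least : ∀ g : Ω → EReal, Measurable[𝒢] g →
    P⟦{ω | (X ω : EReal) ≤ g ω} | 𝒢⟧ =ᵐ[P] (fun _ => 1) → γ ≤ᵐ[P] g

/-- The `k`-th smallest `y_{k:n}` of the first `n` terms of `y`, for `1 ≤ k ≤ n`
(and `0` for other `k`). -/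
noncomputable def orderStat (y : ℕ → ℝ) (k n : ℕ) : ℝ :=
  if h : 1 ≤ k ∧ k ≤ n then
    (fun i : Fin n => y i) (Tuple.sort (fun i : Fin n => y i) ⟨k - 1, by omega⟩)
  else 0

/-- The number of the first `n` terms of `y` that lie in the open interval
`(y_{k:n} - a, y_{k:n})`. -/
noncomputable def nearCount (y : ℕ → ℝ) (k n : ℕ) (a : ℝ) : ℝ :=
  ∑ i ∈ Finset.range n, (Set.Ioo (orderStat y k n - a) (orderStat y k n)).indicator 1 (y i)

/-- The sequence `Y₁, Y₂, …` generated by `Y` along the shift, evaluated at the point `x`: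
index `i` holds `Y_{i+1}(x) = Y(x_{i+1}, x_{i+2}, …)`. -/
def shiftSeq (Y : (ℕ → ℝ) → ℝ) (x : ℕ → ℝ) : ℕ → ℝ := fun i => Y (shift^[i] x)

end NearMax

/-! Choose `c m`, measurable for the almost invariant sets, real and strictly below `γ`, with `c m →
γ`. Almost surely `γ` and `c m` are constant along orbits, so Birkhoff's theorem gives the limiting
frequencies of visits to random half-lines and intervals with these endpoints, as conditional
probabilities.

Minimality of `γ` makes the conditional probability of `Y > c m` positive
(`IsCondRightEndpoint.condProb_lt_pos`). A positive share of the observations then exceeds `c m`,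
while only `n - k n = o(n)` can exceed the order statistic, so the latter eventually lies in `(c m,
γ]`. The count is thus squeezed between the numbers of observations in `(γ - a, c m]` and in `(c m -
a, ∞)` (`tendsto_nearCount_div`). As `m → ∞` both conditional probabilities approach that of `Y > γ
- a`: the lower one because `Y ≠ γ` a.s., the upper one because `Y ≠ γ - a` a.s. -/

namespace NearMax

/-! ### Maximal inequality, Birkhoff's ergodic theorem, limits of conditional expectations -/

section Ergodic

variable {Ω : Type*} {𝒢 m₀ : MeasurableSpace Ω} {μ : Measure Ω} {T : Ω → Ω}

/-- The maximum of `0` and of the Birkhoff sums of `h` with at most `N` terms. -/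
noncomputable def birkhoffMax (T : Ω → Ω) (h : Ω → ℝ) : ℕ → Ω → ℝ
  | 0 => fun _ => 0
  | N + 1 => fun x => max 0 (h x + birkhoffMax T h N (T x))

theorem birkhoffMax_nonneg (h : Ω → ℝ) (N : ℕ) (x : Ω) : 0 ≤ birkhoffMax T h N x := by
  cases N with
  | zero => exact le_rfl
  | succ N => exact le_max_left _ _

theorem birkhoffMax_le_succ (h : Ω → ℝ) (N : ℕ) (x : Ω) :
    birkhoffMax T h N x ≤ birkhoffMax T h (N + 1) x := by
  induction N generalizing x with
  | zero => exact birkhoffMax_nonneg h 1 x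
  | succ N ih => exact max_le_max le_rfl (add_le_add le_rfl (ih (T x)))

theorem birkhoffMax_le_add (h : Ω → ℝ) (N : ℕ) (x : Ω) (hx : 0 < birkhoffMax T h N x) :
    birkhoffMax T h N x ≤ h x + birkhoffMax T h N (T x) := by
  have hle := birkhoffMax_le_succ (T := T) h N x
  rcases le_max_iff.1 hle with h0 | h0
  · exact absurd hx (not_lt.2 h0)
  · exact h0

theorem birkhoffSum_le_birkhoffMax (h : Ω → ℝ) (N : ℕ) (x : Ω) :
    birkhoffSum T h N x ≤ birkhoffMax T h N x := by
  induction N generalizing x with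
  | zero => exact le_rfl
  | succ N ih =>
    rw [birkhoffSum_succ']
    exact le_max_of_le_right (add_le_add le_rfl (ih (T x)))

theorem exists_birkhoffSum_eq_birkhoffMax (h : Ω → ℝ) (N : ℕ) (x : Ω) :
    ∃ n, birkhoffSum T h n x = birkhoffMax T h N x := by
  induction N generalizing x with
  | zero => exact ⟨0, rfl⟩
  | succ N ih =>
    obtain ⟨n, hn⟩ := ih (T x)
    rcases max_choice 0 (h x + birkhoffMax T h N (T x)) with h0 | h0
    · exact ⟨0, h0.symm⟩
    · exact ⟨n + 1, by rw [birkhoffSum_succ', hn]; exact h0.symm⟩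

theorem measurable_birkhoffMax (hT : Measurable T) {h : Ω → ℝ} (hh : Measurable h) (N : ℕ) :
    Measurable (birkhoffMax T h N) := by
  induction N with
  | zero => exact measurable_const
  | succ N ih => exact measurable_const.max (hh.add (ih.comp hT))

theorem integrable_birkhoffMax [IsFiniteMeasure μ] (hT : MeasurePreserving T μ μ) {h : Ω → ℝ}
    (hi : Integrable h μ) (N : ℕ) : Integrable (birkhoffMax T h N) μ := by
  induction N with
  | zero => exact integrable_const _
  | succ N ih =>
    exact (integrable_const (0 : ℝ)).sup (hi.add (hT.integrable_comp_of_integrable ih))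

/-- The maximal ergodic inequality. -/
theorem setIntegral_birkhoffMax_pos_nonneg [IsFiniteMeasure μ] (hT : MeasurePreserving T μ μ)
    {h : Ω → ℝ} (hh : Measurable h) (hi : Integrable h μ) (N : ℕ) :
    0 ≤ ∫ x in {x | 0 < birkhoffMax T h N x}, h x ∂μ := by
  set M := birkhoffMax T h N with hM
  have hMm : Measurable M := measurable_birkhoffMax hT.measurable hh N
  have hMi : Integrable M μ := integrable_birkhoffMax hT hi N
  have hMTi : Integrable (fun x => M (T x)) μ := hT.integrable_comp_of_integrable hMi
  have hs : MeasurableSet {x | 0 < M x} := measurableSet_lt measurable_const hMm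
  have hint : ∫ x, M (T x) ∂μ = ∫ x, M x ∂μ := by
    conv_rhs => rw [← hT.map_eq]
    exact (integral_map hT.measurable.aemeasurable hMm.aestronglyMeasurable).symm
  -- Where `M > 0` the maximum includes the first term, so `M - M ∘ T ≤ h`; elsewhere `M = 0 ≤ M ∘
  -- T`. The left integral vanishes by invariance of `μ`.
  have hle : ∫ x, (M x - M (T x)) ∂μ ≤ ∫ x, {x | 0 < M x}.indicator h x ∂μ := by
    refine integral_mono (hMi.sub hMTi) (hi.indicator hs) fun x => ?_
    by_cases hx : 0 < M x
    · have h1 := birkhoffMax_le_add (T := T) h N x hx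
      simp only [Set.indicator_of_mem (show x ∈ {x | 0 < M x} from hx)]
      rw [← hM] at h1
      linarith
    · simp only [Set.indicator_of_notMem (show x ∉ {x | 0 < M x} from hx)]
      have h1 := birkhoffMax_nonneg (T := T) h N (T x)
      rw [← hM] at h1
      linarith [not_lt.1 hx]
  rwa [integral_indicator hs, integral_sub hMi hMTi, hint, sub_self] at hle

theorem setIntegral_exists_birkhoffSum_pos_nonneg [IsFiniteMeasure μ]
    (hT : MeasurePreserving T μ μ) {h : Ω → ℝ} (hh : Measurable h) (hi : Integrable h μ) :
    0 ≤ ∫ x in {x | ∃ n, 0 < birkhoffSum T h n x}, h x ∂μ := by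
  have hU : {x | ∃ n, 0 < birkhoffSum T h n x} = ⋃ N, {x | 0 < birkhoffMax T h N x} := by
    ext x
    simp only [Set.mem_ofPred_eq, Set.mem_iUnion]
    constructor
    · rintro ⟨n, hn⟩
      exact ⟨n, hn.trans_le (birkhoffSum_le_birkhoffMax h n x)⟩
    · rintro ⟨N, hN⟩
      obtain ⟨n, hn⟩ := exists_birkhoffSum_eq_birkhoffMax (T := T) h N x
      exact ⟨n, hn ▸ hN⟩
  rw [hU]
  refine ge_of_tendsto' (tendsto_setIntegral_of_monotone (fun N => measurableSet_lt
    measurable_const (measurable_birkhoffMax hT.measurable hh N)) ?_ hi.integrableOn)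
    fun N => setIntegral_birkhoffMax_pos_nonneg hT hh hi N
  exact monotone_nat_of_le_succ fun N x hx => lt_of_lt_of_le hx (birkhoffMax_le_succ h N x)

/-- The points whose Birkhoff averages of `g` exceed some level above `ε` infinitely often. -/
def limsupExceeds (T : Ω → Ω) (g : Ω → ℝ) (ε : ℝ) : Set Ω :=
  {x | ∃ δ : ℚ, ε < δ ∧ ∃ᶠ n : ℕ in atTop, (δ : ℝ) * n < birkhoffSum T g n x}

theorem measurable_birkhoffSum (hT : Measurable T) {g : Ω → ℝ} (hg : Measurable g) (n : ℕ) :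
    Measurable (birkhoffSum T g n) :=
  Finset.measurable_fun_sum _ fun i _ => hg.comp (hT.iterate i)

theorem measurableSet_limsupExceeds (hT : Measurable T) {g : Ω → ℝ} (hg : Measurable g) (ε : ℝ) :
    MeasurableSet (limsupExceeds T g ε) := by
  have : limsupExceeds T g ε = ⋃ δ : ℚ, ⋃ _ : ε < δ, ⋂ N : ℕ, ⋃ n : ℕ, ⋃ _ : N ≤ n,
      {x | (δ : ℝ) * n < birkhoffSum T g n x} := by
    ext x
    simp [limsupExceeds, frequently_atTop]
  rw [this]
  exact .iUnion fun δ => .iUnion fun _ => .iInter fun N => .iUnion fun n => .iUnion fun _ =>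
    measurableSet_lt measurable_const (measurable_birkhoffSum hT hg n)

/-- Passing from `x` to `T x` alters the sums by the fixed amount `g x` and the index by one;
lowering `δ` to a rational `q` still above `ε` gains a linear term that absorbs both. -/
theorem preimage_limsupExceeds (g : Ω → ℝ) (ε : ℝ) :
    T ⁻¹' limsupExceeds T g ε = limsupExceeds T g ε := by
  ext x
  simp only [limsupExceeds, Set.mem_preimage, Set.mem_ofPred_eq]
  have large : ∀ c d : ℝ, 0 < d → ∀ᶠ n : ℕ in atTop, c < d * n := fun c d hd =>
    (tendsto_natCast_atTop_atTop.const_mul_atTop hd).eventually_gt_atTop c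
  constructor <;> rintro ⟨δ, hδ, hf⟩
  · obtain ⟨q, hq1, hq2⟩ := exists_rat_btwn hδ
    refine ⟨q, hq1, ?_⟩
    have h1 := hf.and_eventually (large (q - g x) (δ - q) (sub_pos.2 hq2))
    refine (tendsto_add_atTop_nat 1).frequently (h1.mono fun n hn => ?_)
    rw [birkhoffSum_succ']
    push_cast
    linarith [hn.1, hn.2]
  · obtain ⟨q, hq1, hq2⟩ := exists_rat_btwn hδ
    refine ⟨q, hq1, ?_⟩
    have h1 := hf.and_eventually ((large (g x - δ) (δ - q) (sub_pos.2 hq2)).and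
      ((large (g x - q) (δ - q) (sub_pos.2 hq2)).and (eventually_ge_atTop 1)))
    refine (tendsto_sub_atTop_nat 1).frequently (h1.mono fun n hn => ?_)
    obtain ⟨h2, h3, h4, h5⟩ := hn
    obtain ⟨m, rfl⟩ := Nat.exists_eq_add_of_le' h5
    rw [birkhoffSum_succ'] at h2
    push_cast at h2 h3 h4
    simp only [Nat.add_sub_cancel]
    linarith

theorem iterate_mem_iff_of_preimage_eq {B : Set Ω} (hB : T ⁻¹' B = B) (n : ℕ) (x : Ω) :
    T^[n] x ∈ B ↔ x ∈ B := by
  induction n generalizing x with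
  | zero => rfl
  | succ n ih =>
    rw [Function.iterate_succ_apply, ih]
    exact Set.ext_iff.1 hB x

/-- If `g` integrates to zero over strictly invariant sets, then the upper limit of its Birkhoff
averages is almost surely at most any `ε > 0`. -/
theorem measure_limsupExceeds_eq_zero [IsFiniteMeasure μ] (hT : MeasurePreserving T μ μ)
    {g : Ω → ℝ} (hg : Measurable g) (hgi : Integrable g μ)
    (hint : ∀ B, MeasurableSet B → T ⁻¹' B = B → ∫ x in B, g x ∂μ = 0) {ε : ℝ} (hε : 0 < ε) :
    μ (limsupExceeds T g ε) = 0 := by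
  set B := limsupExceeds T g ε
  have hB : MeasurableSet B := measurableSet_limsupExceeds hT.measurable hg ε
  have hBT : T ⁻¹' B = B := preimage_limsupExceeds g ε
  -- Since `B` is invariant, the sums of `h` are those of `g - ε` on `B` and zero off it, so some
  -- sum is positive exactly on `B`. The maximal inequality then reads `0 ≤ -ε μ(B)`.
  set h : Ω → ℝ := B.indicator (fun x => g x - ε) with hh
  have hgε : Integrable (fun x => g x - ε) μ := hgi.sub (integrable_const ε)
  have hset : {x | ∃ n, 0 < birkhoffSum T h n x} = B := by
    ext x
    simp only [Set.mem_ofPred_eq]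
    by_cases hx : x ∈ B
    · simp only [hx, iff_true]
      have hx' := hx
      obtain ⟨δ, hδ, hf⟩ := hx'
      obtain ⟨n, hn, hn1⟩ := (hf.and_eventually (eventually_ge_atTop 1)).exists
      refine ⟨n, ?_⟩
      have : birkhoffSum T h n x = birkhoffSum T g n x - n * ε := by
        simp only [birkhoffSum]
        rw [Finset.sum_congr rfl fun i _ => Set.indicator_of_mem
          ((iterate_mem_iff_of_preimage_eq hBT i x).2 hx) _, Finset.sum_sub_distrib]
        simp
      rw [this]
      have : (1 : ℝ) ≤ n := by exact_mod_cast hn1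
      nlinarith
    · simp only [hx, iff_false, not_exists, not_lt]
      intro n
      refine (Finset.sum_eq_zero fun i _ => Set.indicator_of_notMem ?_ _).le
      rwa [iterate_mem_iff_of_preimage_eq hBT i x]
  have key := setIntegral_exists_birkhoffSum_pos_nonneg (h := h) hT
    ((hg.sub measurable_const).indicator hB) (hgε.indicator hB)
  rw [hset, hh, setIntegral_indicator hB, Set.inter_self,
    integral_sub hgi.integrableOn (integrable_const ε).integrableOn, hint B hB hBT,
    setIntegral_const, smul_eq_mul] at key
  have hr : μ.real B ≤ 0 := by nlinarith
  exact (measureReal_eq_zero_iff).1 (le_antisymm hr measureReal_nonneg)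

theorem ae_eventually_birkhoffSum_le [IsFiniteMeasure μ] (hT : MeasurePreserving T μ μ)
    {g : Ω → ℝ} (hg : Measurable g) (hgi : Integrable g μ)
    (hint : ∀ B, MeasurableSet B → T ⁻¹' B = B → ∫ x in B, g x ∂μ = 0) :
    ∀ᵐ x ∂μ, ∀ ε : ℝ, 0 < ε → ∀ᶠ n : ℕ in atTop, birkhoffSum T g n x ≤ ε * n := by
  have h1 : ∀ᵐ x ∂μ, ∀ q : {q : ℚ // 0 < q}, x ∉ limsupExceeds T g (q : ℚ) :=
    ae_all_iff.2 fun q => measure_eq_zero_iff_ae_notMem.1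
      (measure_limsupExceeds_eq_zero hT hg hgi hint (by exact_mod_cast q.2))
  filter_upwards [h1] with x hx ε hε
  obtain ⟨δ, hδ0, hδ⟩ := exists_rat_btwn hε
  obtain ⟨q, hq0, hq⟩ := exists_rat_btwn hδ0
  have h2 := hx ⟨q, by exact_mod_cast hq0⟩
  simp only [limsupExceeds, Set.mem_ofPred_eq, not_exists, not_and, not_frequently, not_lt] at h2
  filter_upwards [h2 δ hq] with n hn
  exact hn.trans (mul_le_mul_of_nonneg_right hδ.le n.cast_nonneg)

theorem ae_tendsto_birkhoffSum_div_zero [IsFiniteMeasure μ] (hT : MeasurePreserving T μ μ)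
    {g : Ω → ℝ} (hg : Measurable g) (hgi : Integrable g μ)
    (hint : ∀ B, MeasurableSet B → T ⁻¹' B = B → ∫ x in B, g x ∂μ = 0) :
    ∀ᵐ x ∂μ, Tendsto (fun n : ℕ => birkhoffSum T g n x / n) atTop (𝓝 0) := by
  have hneg : ∀ B, MeasurableSet B → T ⁻¹' B = B → ∫ x in B, (-g) x ∂μ = 0 := by
    intro B hB hBT
    simp [integral_neg, hint B hB hBT]
  filter_upwards [ae_eventually_birkhoffSum_le hT hg hgi hint,
    ae_eventually_birkhoffSum_le hT hg.neg hgi.neg hneg] with x h1 h2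
  refine Metric.tendsto_nhds.2 fun ε hε => ?_
  filter_upwards [h1 (ε / 2) (by positivity), h2 (ε / 2) (by positivity),
    eventually_gt_atTop 0] with n hn1 hn2 hn
  have hn' : (0 : ℝ) < n := by exact_mod_cast hn
  have hneg' : birkhoffSum T (-g) n x = - birkhoffSum T g n x := by
    simp [birkhoffSum, Finset.sum_neg_distrib]
  rw [hneg'] at hn2
  rw [Real.dist_eq, sub_zero, abs_lt, lt_div_iff₀ hn', div_lt_iff₀ hn']
  constructor <;> nlinarith

theorem ae_forall_iterate_eq {β : Type*} (hT : MeasurePreserving T μ μ) {f : Ω → β}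
    (hf : ∀ᵐ x ∂μ, f (T x) = f x) : ∀ᵐ x ∂μ, ∀ n, f (T^[n] x) = f x := by
  have h : ∀ᵐ x ∂μ, ∀ n, f (T (T^[n] x)) = f (T^[n] x) :=
    ae_all_iff.2 fun n => (hT.iterate n).quasiMeasurePreserving.ae hf
  filter_upwards [h] with x hx n
  induction n with
  | zero => rfl
  | succ n ih => rw [Function.iterate_succ_apply', hx n, ih]

/-- An extended random variable that is measurable for almost invariant sets is almost
invariant. -/
theorem ae_comp_eq_of_measurable (hinv : ∀ A, MeasurableSet[𝒢] A → T ⁻¹' A =ᵐ[μ] A)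
    {f : Ω → EReal} (hf : Measurable[𝒢] f) :
    ∀ᵐ x ∂μ, f (T x) = f x := by
  have h : ∀ᵐ x ∂μ, ∀ q : ℚ, (((q : ℝ) : EReal) < f (T x) ↔ ((q : ℝ) : EReal) < f x) := by
    refine ae_all_iff.2 fun q => ?_
    have := hinv (f ⁻¹' Set.Ioi ((q : ℝ) : EReal)) (hf measurableSet_Ioi)
    filter_upwards [this] with x hx
    exact iff_of_eq hx
  filter_upwards [h] with x hx
  refine le_antisymm (not_lt.1 fun hlt => ?_) (not_lt.1 fun hlt => ?_)
  · obtain ⟨q, h1, h2⟩ := EReal.lt_iff_exists_rat_btwn.1 hlt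
    exact lt_asymm h1 ((hx q).1 h2)
  · obtain ⟨q, h1, h2⟩ := EReal.lt_iff_exists_rat_btwn.1 hlt
    exact lt_asymm h1 ((hx q).2 h2)

/-- Birkhoff's pointwise ergodic theorem, for a σ-field `𝒢` that contains all strictly invariant
sets and consists of almost invariant sets. -/
theorem ae_tendsto_birkhoffSum_div_condExp [IsFiniteMeasure μ] (hT : MeasurePreserving T μ μ)
    (h𝒢 : 𝒢 ≤ m₀)
    (hstrict : ∀ A, MeasurableSet[m₀] A → T ⁻¹' A = A → MeasurableSet[𝒢] A)
    (hinv : ∀ A, MeasurableSet[𝒢] A → T ⁻¹' A =ᵐ[μ] A)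
    {f : Ω → ℝ} (hf : Measurable f) (hfi : Integrable f μ) :
    ∀ᵐ x ∂μ, Tendsto (fun n : ℕ => birkhoffSum T f n x / n) atTop (𝓝 ((μ[f | 𝒢]) x)) := by
  have hcm : Measurable[𝒢] (μ[f | 𝒢]) := stronglyMeasurable_condExp.measurable
  have hzero := ae_tendsto_birkhoffSum_div_zero hT (g := f - μ[f | 𝒢])
    (hf.sub (hcm.mono h𝒢 le_rfl)) (hfi.sub integrable_condExp) fun B hB hBT => by
      simp only [Pi.sub_apply]
      rw [integral_sub hfi.integrableOn integrable_condExp.integrableOn,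
        setIntegral_condExp h𝒢 hfi (hstrict B hB hBT), sub_self]
  -- Invariance turns the Birkhoff sum of the conditional expectation into `n` times its value.
  have hcT : ∀ᵐ x ∂μ, (μ[f | 𝒢]) (T x) = (μ[f | 𝒢]) x := by
    filter_upwards [ae_comp_eq_of_measurable hinv
      (measurable_coe_real_ereal.comp hcm)] with x hx
    exact EReal.coe_injective hx
  filter_upwards [hzero, ae_forall_iterate_eq hT hcT] with x hx hc
  have hlim := hx.add_const ((μ[f | 𝒢]) x)
  rw [zero_add] at hlim
  refine hlim.congr' ?_
  filter_upwards [eventually_gt_atTop 0] with n hn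
  have hn' : (n : ℝ) ≠ 0 := by exact_mod_cast hn.ne'
  have : birkhoffSum T (f - μ[f | 𝒢]) n x = birkhoffSum T f n x - n * (μ[f | 𝒢]) x := by
    simp only [birkhoffSum, Pi.sub_apply, Finset.sum_sub_distrib, hc]
    simp
  rw [this]
  field_simp
  ring

/-- Along a dominated, almost surely convergent sequence the conditional expectations converge
almost surely on a subsequence. -/
theorem exists_subseq_ae_tendsto_condExp (h𝒢 : 𝒢 ≤ m₀)
    [IsFiniteMeasure μ] {fs : ℕ → Ω → ℝ} {f : Ω → ℝ} (bound : Ω → ℝ)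
    (hfs : ∀ n, AEStronglyMeasurable (fs n) μ) (hbound : Integrable bound μ)
    (hle : ∀ n, ∀ᵐ x ∂μ, ‖fs n x‖ ≤ bound x)
    (hlim : ∀ᵐ x ∂μ, Tendsto (fun n => fs n x) atTop (𝓝 (f x))) :
    ∃ ns : ℕ → ℕ, StrictMono ns ∧
      ∀ᵐ x ∂μ, Tendsto (fun i => (μ[fs (ns i) | 𝒢]) x) atTop (𝓝 ((μ[f | 𝒢]) x)) := by
  have h := tendsto_condExpL1_of_dominated_convergence h𝒢 bound hfs hbound hle hlim
  obtain ⟨ns, hns, hae⟩ := (tendstoInMeasure_of_tendsto_Lp h).exists_seq_tendsto_ae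
  refine ⟨ns, hns, ?_⟩
  have h2 : ∀ᵐ x ∂μ, ∀ n, (μ[fs n | 𝒢]) x = condExpL1 h𝒢 μ (fs n) x :=
    ae_all_iff.2 fun n => condExp_ae_eq_condExpL1 h𝒢 (fs n)
  filter_upwards [hae, h2, condExp_ae_eq_condExpL1 h𝒢 f] with x h3 h4 h5
  simpa only [h4, h5] using h3

end Ergodic

/-! ### Order statistics and the deterministic squeeze -/

section OrderStatistics

theorem exists_orderStat_eq (y : ℕ → ℝ) {k n : ℕ} (hk : 1 ≤ k ∧ k ≤ n) :
    ∃ i, orderStat y k n = y i := by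
  rw [orderStat, dif_pos hk]
  exact ⟨_, rfl⟩

theorem sum_indicator_Ioi_orderStat_le (y : ℕ → ℝ) {k n : ℕ} (hk : 1 ≤ k ∧ k ≤ n) {c : ℝ}
    (hc : orderStat y k n ≤ c) :
    ∑ i ∈ Finset.range n, (Set.Ioi c).indicator (1 : ℝ → ℝ) (y i) ≤ (n : ℝ) - k := by
  rw [orderStat, dif_pos hk] at hc
  set f : Fin n → ℝ := fun i => y i
  -- Zero-based position of the `k`-th smallest term: only the `n - k` later sorted positions can
  -- hold a value above `c`.
  set j₀ : Fin n := ⟨k - 1, by omega⟩ with hj₀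
  have hmono : Monotone (f ∘ Tuple.sort f) := Tuple.monotone_sort f
  have hcard : ((Finset.Ioi j₀).card : ℝ) = (n : ℝ) - k := by
    rw [Fin.card_Ioi, ← Nat.cast_sub hk.2]
    congr 1
    simp only [hj₀]
    omega
  calc ∑ i ∈ Finset.range n, (Set.Ioi c).indicator (1 : ℝ → ℝ) (y i)
      = ∑ i : Fin n, (Set.Ioi c).indicator (1 : ℝ → ℝ) (f i) :=
        Finset.sum_range fun i => (Set.Ioi c).indicator (1 : ℝ → ℝ) (y i)
    _ = ∑ j : Fin n, (Set.Ioi c).indicator (1 : ℝ → ℝ) (f (Tuple.sort f j)) :=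
        (Equiv.sum_comp (Tuple.sort f) _).symm
    _ ≤ ∑ j : Fin n, if j ∈ Finset.Ioi j₀ then (1 : ℝ) else 0 := by
        refine Finset.sum_le_sum fun j _ => ?_
        by_cases hj : j₀ < j
        · rw [if_pos (Finset.mem_Ioi.2 hj)]
          exact Set.indicator_le_self' (fun _ _ => zero_le_one) _
        · rw [if_neg (by simpa using hj), Set.indicator_of_notMem]
          exact not_lt.2 ((hmono (not_lt.1 hj)).trans hc)
    _ = (n : ℝ) - k := by
        rw [← hcard, Finset.sum_ite_mem, Finset.univ_inter, Finset.sum_const, nsmul_one]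

/-- Otherwise at most a share `1 - k n / n → 0` of the terms would exceed `c`, against the limiting
share `p > 0`. -/
theorem eventually_lt_orderStat {y : ℕ → ℝ} {k : ℕ → ℕ} (hk : ∀ n, 1 ≤ n → 1 ≤ k n ∧ k n ≤ n)
    (hk_lim : Tendsto (fun n => (k n : ℝ) / (n : ℝ)) atTop (𝓝 1)) {c p : ℝ} (hp : 0 < p)
    (h : Tendsto (fun n : ℕ => (∑ i ∈ Finset.range n, (Set.Ioi c).indicator 1 (y i)) / (n : ℝ))
      atTop (𝓝 p)) :
    ∀ᶠ n in atTop, c < orderStat y (k n) n := by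
  have h0 : Tendsto (fun n => 1 - (k n : ℝ) / (n : ℝ)) atTop (𝓝 (1 - 1)) :=
    hk_lim.const_sub 1
  rw [sub_self] at h0
  filter_upwards [h0.eventually_lt h hp, eventually_ge_atTop 1] with n hn hn1
  by_contra hcon
  have h1 := sum_indicator_Ioi_orderStat_le y (hk n hn1) (not_lt.1 hcon)
  have hn' : (0 : ℝ) < n := by exact_mod_cast hn1
  rw [lt_div_iff₀ hn', sub_mul, one_mul, div_mul_cancel₀ _ hn'.ne'] at hn
  exact absurd h1 (not_le.2 hn)

/-- The asymptotic proportion of near-order-statistic observations along a single sequence whose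
empirical frequencies converge. -/
theorem tendsto_nearCount_div {y : ℕ → ℝ} {k : ℕ → ℕ} (hk : ∀ n, 1 ≤ n → 1 ≤ k n ∧ k n ≤ n)
    (hk_lim : Tendsto (fun n => (k n : ℝ) / (n : ℝ)) atTop (𝓝 1)) {a : ℝ} {z : EReal}
    (hy : ∀ i, (y i : EReal) ≤ z) {c p u l : ℕ → ℝ} (hp0 : ∀ m, 0 < p m)
    (hp : ∀ m, Tendsto (fun n : ℕ => (∑ i ∈ Finset.range n,
      (Set.Ioi (c m)).indicator 1 (y i)) / (n : ℝ)) atTop (𝓝 (p m)))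
    (hu : ∀ m, Tendsto (fun n : ℕ => (∑ i ∈ Finset.range n,
      (Set.Ioi (c m - a)).indicator 1 (y i)) / (n : ℝ)) atTop (𝓝 (u m)))
    (hl : ∀ m, Tendsto (fun n : ℕ => (∑ i ∈ Finset.range n,
      {r : ℝ | z - (a : EReal) < (r : EReal) ∧ r ≤ c m}.indicator 1 (y i)) / (n : ℝ))
      atTop (𝓝 (l m)))
    {φ ψ : ℕ → ℕ} {q : ℝ} (hφ : Tendsto (fun i => u (φ i)) atTop (𝓝 q))
    (hψ : Tendsto (fun i => l (ψ i)) atTop (𝓝 q)) :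
    Tendsto (fun n : ℕ => nearCount y (k n) n a / (n : ℝ)) atTop (𝓝 q) := by
  refine tendsto_order.2 ⟨fun b hb => ?_, fun b hb => ?_⟩
  · obtain ⟨i, hi⟩ := (hψ.eventually_const_lt hb).exists
    filter_upwards [(hl (ψ i)).eventually_const_lt hi,
      eventually_lt_orderStat hk hk_lim (hp0 (ψ i)) (hp (ψ i)), eventually_ge_atTop 1]
      with n h1 h2 h3
    refine h1.trans_le (div_le_div_of_nonneg_right (Finset.sum_le_sum fun j _ => ?_)
      n.cast_nonneg)
    refine Set.indicator_le_indicator_of_subset ?_ (fun _ => zero_le_one) _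
    rintro r ⟨hr1, hr2⟩
    refine ⟨?_, hr2.trans_lt h2⟩
    -- The order statistic is one of the terms, hence at most `z`.
    obtain ⟨j, hj⟩ := exists_orderStat_eq y (hk n h3)
    rw [hj, ← EReal.coe_lt_coe_iff, EReal.coe_sub]
    exact (EReal.sub_le_sub (hy j) le_rfl).trans_lt hr1
  · obtain ⟨i, hi⟩ := (hφ.eventually_lt_const hb).exists
    filter_upwards [(hu (φ i)).eventually_lt_const hi,
      eventually_lt_orderStat hk hk_lim (hp0 (φ i)) (hp (φ i))] with n h1 h2
    refine (div_le_div_of_nonneg_right (Finset.sum_le_sum fun j _ => ?_)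
      n.cast_nonneg).trans_lt h1
    refine Set.indicator_le_indicator_of_subset ?_ (fun _ => zero_le_one) _
    rintro r ⟨hr1, -⟩
    exact (sub_lt_sub_right h2 a).trans hr1

end OrderStatistics

/-! ### Conditional right endpoint -/

section Endpoint

variable {Ω : Type*} {𝒢 m₀ : MeasurableSpace Ω} {P : Measure Ω} [IsProbabilityMeasure P]

/-- The conditional probability integrates to `P A`. This turns the conditions on `γ` and its
competitors into plain a.s. inequalities. -/
theorem condProb_ae_eq_one_iff (h𝒢 : 𝒢 ≤ m₀) {A : Set Ω} (hA : MeasurableSet A) :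
    P⟦A | 𝒢⟧ =ᵐ[P] (fun _ => 1) ↔ ∀ᵐ x ∂P, x ∈ A := by
  constructor
  · intro h
    have h1 : ∫ x, (P⟦A | 𝒢⟧) x ∂P = P.real A := by
      rw [integral_condExp h𝒢, integral_indicator_const _ hA]
      simp
    rw [integral_congr_ae h, integral_const, probReal_univ, one_smul] at h1
    refine (mem_ae_iff_prob_eq_one hA).2 ?_
    rw [← ofReal_measureReal, ← h1, ENNReal.ofReal_one]
  · intro h
    have h1 : A.indicator (fun _ => (1 : ℝ)) =ᵐ[P] fun _ => 1 := by
      filter_upwards [h] with x hx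
      exact Set.indicator_of_mem hx _
    refine (condExp_congr_ae h1).trans ?_
    rw [condExp_const h𝒢]

/-- An upper bound strictly below the conditional right endpoint is exceeded with positive
conditional probability. -/
theorem IsCondRightEndpoint.condProb_lt_pos {X : Ω → ℝ} (hX : Measurable X) {γ : Ω → EReal}
    (hγ : IsCondRightEndpoint P X 𝒢 γ) {c : Ω → ℝ} (hc : Measurable[𝒢] c)
    (hcγ : ∀ᵐ x ∂P, (c x : EReal) < γ x) :
    ∀ᵐ x ∂P, 0 < (P⟦{ω | c ω < X ω} | 𝒢⟧) x := by
  have h𝒢 := hγ.sub_field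
  have hA : MeasurableSet {ω | c ω < X ω} := measurableSet_lt (hc.mono h𝒢 le_rfl) hX
  have hXm : Measurable fun ω => (X ω : EReal) := measurable_coe_real_ereal.comp hX
  set N : Set Ω := {x | (P⟦{ω | c ω < X ω} | 𝒢⟧) x ≤ 0} with hN
  have hNm : MeasurableSet[𝒢] N :=
    @measurableSet_le _ _ _ _ _ 𝒢 _ _ _ _ _ stronglyMeasurable_condExp.measurable
      measurable_const
  have hnull : P ({ω | c ω < X ω} ∩ N) = 0 := by
    have h1 := setIntegral_condExp h𝒢
      ((integrable_const (1 : ℝ)).indicator hA : Integrable _ P) hNm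
    rw [setIntegral_indicator hA, setIntegral_const, smul_eq_mul, mul_one] at h1
    have h2 : ∫ x in N, (P⟦{ω | c ω < X ω} | 𝒢⟧) x ∂P ≤ 0 :=
      setIntegral_nonpos (h𝒢 _ hNm) fun x hx => hx
    rw [h1, Set.inter_comm] at h2
    exact (measureReal_eq_zero_iff).1 (le_antisymm h2 measureReal_nonneg)
  classical
  -- On `N` almost surely `X ≤ c`, so lowering `γ` to `c` there still bounds `X`; minimality of `γ`
  -- then forces `N` to be null.
  set g : Ω → EReal := N.piecewise (fun x => (c x : EReal)) γ with hg
  have hgm : Measurable[𝒢] g :=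
    Measurable.piecewise hNm (measurable_coe_real_ereal.comp hc) hγ.measurable
  have hle : ∀ᵐ x ∂P, x ∈ {ω | (X ω : EReal) ≤ γ ω} :=
    (condProb_ae_eq_one_iff h𝒢 (measurableSet_le hXm (hγ.measurable.mono h𝒢 le_rfl))).1
      hγ.le_endpoint
  have hXg : ∀ᵐ x ∂P, x ∈ {ω | (X ω : EReal) ≤ g ω} := by
    filter_upwards [hle, measure_eq_zero_iff_ae_notMem.1 hnull] with x h1 h2
    by_cases hx : x ∈ N
    · have h3 : X x ≤ c x := not_lt.1 fun h => h2 ⟨h, hx⟩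
      simpa [hg, hx] using h3
    · simpa [hg, hx] using h1
  have hγg := hγ.least g hgm
    ((condProb_ae_eq_one_iff h𝒢 (measurableSet_le hXm (hgm.mono h𝒢 le_rfl))).2 hXg)
  filter_upwards [hγg, hcγ] with x h1 h2
  by_contra hx
  have hxN : x ∈ N := not_lt.1 hx
  rw [hg, Set.piecewise_eq_of_mem _ _ _ hxN] at h1
  exact absurd h2 (not_lt.2 h1)

end Endpoint

/-! ### Real approximation of the endpoint from below -/

section Approximation

/-- A real sequence approximating the extended real `z > -∞` strictly from below. -/
noncomputable def lowerApprox (m : ℕ) (z : EReal) : ℝ :=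
  if z = ⊤ then m else z.toReal - 1 / ((m : ℝ) + 1)

theorem measurable_lowerApprox (m : ℕ) : Measurable (lowerApprox m) :=
  Measurable.ite (measurableSet_singleton _) measurable_const
    (measurable_ereal_toReal.sub measurable_const)

theorem lowerApprox_lt (m : ℕ) {z : EReal} (hz : z ≠ ⊥) : (lowerApprox m z : EReal) < z := by
  induction z with
  | bot => exact absurd rfl hz
  | top => exact EReal.coe_lt_top _
  | coe r =>
    have : (0 : ℝ) < 1 / ((m : ℝ) + 1) := by positivity
    simp only [lowerApprox, EReal.coe_ne_top, if_false, EReal.toReal_coe, EReal.coe_lt_coe_iff]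
    linarith

theorem eventually_lt_lowerApprox {z : EReal} {r : ℝ} (hr : (r : EReal) < z) :
    ∀ᶠ m in atTop, r < lowerApprox m z := by
  induction z with
  | bot => exact absurd hr not_lt_bot
  | top =>
    simp only [lowerApprox, if_true]
    exact tendsto_natCast_atTop_atTop.eventually_gt_atTop r
  | coe s =>
    simp only [lowerApprox, EReal.coe_ne_top, if_false, EReal.toReal_coe]
    have h := (tendsto_one_div_add_atTop_nhds_zero_nat (𝕜 := ℝ)).const_sub s
    rw [sub_zero] at h
    exact h.eventually_const_lt (EReal.coe_lt_coe_iff.1 hr)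

theorem coe_lt_sub_coe_iff {z : EReal} {r a : ℝ} :
    (r : EReal) < z - (a : EReal) ↔ ((r + a : ℝ) : EReal) < z := by
  induction z with
  | bot => simp
  | top => simp only [EReal.top_sub_coe, EReal.coe_lt_top]
  | coe s =>
    rw [← EReal.coe_sub, EReal.coe_lt_coe_iff, EReal.coe_lt_coe_iff, lt_sub_iff_add_lt]

end Approximation

/-! ### Ergodic theorem for the shift -/

section Shift

variable {Q : Measure (ℕ → ℝ)}

theorem preimage_ae_eq_of_almostInvariant {A : Set (ℕ → ℝ)}
    (hA : MeasurableSet[almostInvariant Q] A) : shift ⁻¹' A =ᵐ[Q] A := by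
  have h : Q (A \ shift ⁻¹' A ∪ shift ⁻¹' A \ A) = 0 := hA.2
  rw [measure_union_null_iff] at h
  exact ae_eq_set.2 ⟨h.2, h.1⟩

/-- The ergodic theorem for the frequency of visits of the shifted sequence to a Borel set. -/
theorem ae_tendsto_frequency [IsProbabilityMeasure Q] (hQ : MeasurePreserving shift Q Q)
    {A : Set (ℕ → ℝ)} (hA : MeasurableSet A) :
    ∀ᵐ x ∂Q, Tendsto (fun n : ℕ => (∑ i ∈ Finset.range n,
      A.indicator (fun _ => (1 : ℝ)) (shift^[i] x)) / (n : ℝ)) atTop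
      (𝓝 ((Q⟦A | almostInvariant Q⟧) x)) :=
  ae_tendsto_birkhoffSum_div_condExp hQ (almostInvariant_le Q)
    (fun B hB hBT => ⟨hB, by simp [hBT]⟩) (fun _ => preimage_ae_eq_of_almostInvariant)
    (measurable_const.indicator hA) ((integrable_const (1 : ℝ)).indicator hA)

end Shift

end NearMax

/-! ### Main theorem -/

theorem theorem3p1 (Q : Measure (ℕ → ℝ)) [IsProbabilityMeasure Q]
    (hQ : MeasurePreserving NearMax.shift Q Q)
    (Y : (ℕ → ℝ) → ℝ) (hY : Measurable Y)
    (k : ℕ → ℕ) (hk : ∀ n, 1 ≤ n → 1 ≤ k n ∧ k n ≤ n)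
    (hk_lim : Tendsto (fun n => (k n : ℝ) / (n : ℝ)) atTop (𝓝 1))
    (a : ℝ) (ha : 0 < a)
    (γ : (ℕ → ℝ) → EReal)
    (hγ : NearMax.IsCondRightEndpoint Q Y (NearMax.almostInvariant Q) γ)
    (h_end : Q {x | (Y x : EReal) = γ x} = 0)
    (h_end_sub : Q {x | (Y x : EReal) = γ x - (a : EReal)} = 0) :
    ∀ᵐ x ∂Q, Tendsto
      (fun n : ℕ => NearMax.nearCount (NearMax.shiftSeq Y x) (k n) n a / (n : ℝ)) atTop
      (𝓝 ((Q⟦{x | γ x - (a : EReal) < (Y x : EReal)} | NearMax.almostInvariant Q⟧) x)) := by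
  have hle := NearMax.almostInvariant_le Q
  have hγm : Measurable γ := hγ.measurable.mono hle le_rfl
  have hYm : Measurable fun x => (Y x : EReal) := measurable_coe_real_ereal.comp hY
  have hγam : Measurable fun x => γ x - (a : EReal) := by
    simp only [sub_eq_add_neg]
    exact hγm.add measurable_const
  set c : ℕ → (ℕ → ℝ) → ℝ := fun m x => NearMax.lowerApprox m (γ x) with hc
  have hcI : ∀ m, Measurable[NearMax.almostInvariant Q] (c m) := fun m =>
    (NearMax.measurable_lowerApprox m).comp hγ.measurable
  have hcm : ∀ m, Measurable (c m) := fun m => (hcI m).mono hle le_rfl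
  set G : Set (ℕ → ℝ) := {x | γ x - (a : EReal) < (Y x : EReal)} with hG
  set A : ℕ → Set (ℕ → ℝ) := fun m => {x | c m x < Y x} with hA
  set U : ℕ → Set (ℕ → ℝ) := fun m => {x | c m x - a < Y x} with hU
  set L : ℕ → Set (ℕ → ℝ) := fun m => G ∩ {x | Y x ≤ c m x} with hL
  have hGm : MeasurableSet G := measurableSet_lt hγam hYm
  have hAm : ∀ m, MeasurableSet (A m) := fun m => measurableSet_lt (hcm m) hY
  have hUm : ∀ m, MeasurableSet (U m) := fun m =>
    measurableSet_lt ((hcm m).sub measurable_const) hY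
  have hLm : ∀ m, MeasurableSet (L m) := fun m => hGm.inter (measurableSet_le hY (hcm m))
  have hYγ : ∀ᵐ x ∂Q, x ∈ {x | (Y x : EReal) ≤ γ x} :=
    (NearMax.condProb_ae_eq_one_iff hle (measurableSet_le hYm hγm)).1 hγ.le_endpoint
  -- At `⊥` the value of `lowerApprox` is meaningless; a real `Y ≤ γ` excludes that case.
  have hbot : ∀ᵐ x ∂Q, γ x ≠ ⊥ := by
    filter_upwards [hYγ] with x hx h0
    exact absurd (h0 ▸ hx : (Y x : EReal) ≤ ⊥) (not_le.2 (EReal.bot_lt_coe _))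
  have hcγ : ∀ m, ∀ᵐ x ∂Q, (c m x : EReal) < γ x := fun m => by
    filter_upwards [hbot] with x hx using NearMax.lowerApprox_lt m hx
  have hYγlt : ∀ᵐ x ∂Q, (Y x : EReal) < γ x := by
    filter_upwards [hYγ, measure_eq_zero_iff_ae_notMem.1 h_end] with x h1 h2
    exact lt_of_le_of_ne h1 h2
  have hone : ∀ (B : Set (ℕ → ℝ)), ∀ᵐ x ∂Q, ‖B.indicator (fun _ => (1 : ℝ)) x‖ ≤ 1 := fun B =>
    Eventually.of_forall fun x =>
      (norm_indicator_le_norm_self (fun _ => (1 : ℝ)) x).trans (by simp)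
  -- Indicators of `U m` converge to that of `G` except possibly where `Y = γ - a`. A subsequence
  -- suffices, since the squeeze needs just one good `m` for each tolerance.
  obtain ⟨φ, -, hφ⟩ := NearMax.exists_subseq_ae_tendsto_condExp hle (μ := Q)
    (fs := fun m => (U m).indicator fun _ => (1 : ℝ)) (f := G.indicator fun _ => (1 : ℝ))
    (fun _ => 1) (fun m => (measurable_const.indicator (hUm m)).aestronglyMeasurable)
    (integrable_const _) (fun m => hone _) (by
      filter_upwards [ae_all_iff.2 hcγ, measure_eq_zero_iff_ae_notMem.1 h_end_sub] with x h1 h2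
      refine tendsto_const_nhds.congr' ?_
      by_cases hx : x ∈ G
      · refine Eventually.of_forall fun m => ?_
        have : x ∈ U m := by
          by_contra hcon
          have h3 : Y x + a ≤ c m x := by
            have : Y x ≤ c m x - a := not_lt.1 hcon
            linarith
          exact lt_asymm hx (NearMax.coe_lt_sub_coe_iff.2
            ((EReal.coe_le_coe_iff.2 h3).trans_lt (h1 m)))
        simp [hx, this]
      · have h3 : (Y x : EReal) < γ x - (a : EReal) := lt_of_le_of_ne (not_lt.1 hx) h2
        filter_upwards [NearMax.eventually_lt_lowerApprox
          (NearMax.coe_lt_sub_coe_iff.1 h3)] with m hm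
        have : x ∉ U m := by
          intro hcon
          have : c m x - a < Y x := hcon
          have : Y x + a < c m x := hm
          linarith
        simp [hx, this])
  -- Here `Y < γ` a.s. is what makes the cut `Y ≤ c m` disappear in the limit.
  obtain ⟨ψ, -, hψ⟩ := NearMax.exists_subseq_ae_tendsto_condExp hle (μ := Q)
    (fs := fun m => (L m).indicator fun _ => (1 : ℝ)) (f := G.indicator fun _ => (1 : ℝ))
    (fun _ => 1) (fun m => (measurable_const.indicator (hLm m)).aestronglyMeasurable)
    (integrable_const _) (fun m => hone _) (by
      filter_upwards [hYγlt] with x h1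
      refine tendsto_const_nhds.congr' ?_
      filter_upwards [NearMax.eventually_lt_lowerApprox h1] with m hm
      have h2 : x ∈ L m ↔ x ∈ G := and_iff_left hm.le
      by_cases hx : x ∈ G
      · simp [hx, h2.2 hx]
      · simp [hx, mt h2.1 hx])
  have hγT : ∀ᵐ x ∂Q, ∀ n, γ (NearMax.shift^[n] x) = γ x :=
    NearMax.ae_forall_iterate_eq hQ (NearMax.ae_comp_eq_of_measurable
      (fun _ => NearMax.preimage_ae_eq_of_almostInvariant) hγ.measurable)
  have hYT : ∀ᵐ x ∂Q, ∀ n, (Y (NearMax.shift^[n] x) : EReal) ≤ γ (NearMax.shift^[n] x) :=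
    ae_all_iff.2 fun n => (hQ.iterate n).quasiMeasurePreserving.ae hYγ
  filter_upwards [hφ, hψ, hγT, hYT,
    ae_all_iff.2 fun m => hγ.condProb_lt_pos hY (hcI m) (hcγ m),
    ae_all_iff.2 fun m => NearMax.ae_tendsto_frequency hQ (hAm m),
    ae_all_iff.2 fun m => NearMax.ae_tendsto_frequency hQ (hUm m),
    ae_all_iff.2 fun m => NearMax.ae_tendsto_frequency hQ (hLm m)]
    with x hφx hψx hγx hYx hpos hAx hUx hLx
  -- Constancy along the orbit turns visits to `A m`, `U m`, `L m` into visits of the terms to fixed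
  -- sets of reals.
  have hcx : ∀ m i, c m (NearMax.shift^[i] x) = c m x := fun m i => by simp only [hc, hγx i]
  refine NearMax.tendsto_nearCount_div (z := γ x) (c := fun m => c m x)
    (u := fun m => (Q⟦U m | NearMax.almostInvariant Q⟧) x)
    (l := fun m => (Q⟦L m | NearMax.almostInvariant Q⟧) x) (φ := φ) (ψ := ψ) hk hk_lim
    (fun i => (hYx i).trans_eq (hγx i)) hpos (fun m => ?_) (fun m => ?_) (fun m => ?_) hφx hψx
  · refine (hAx m).congr fun n => ?_
    congr 1
    refine Finset.sum_congr rfl fun i _ => ?_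
    simp only [Set.indicator, hA, Set.mem_ofPred_eq, Set.mem_Ioi, hcx, Pi.one_apply]
  · refine (hUx m).congr fun n => ?_
    congr 1
    refine Finset.sum_congr rfl fun i _ => ?_
    simp only [Set.indicator, hU, Set.mem_ofPred_eq, Set.mem_Ioi, hcx, Pi.one_apply]
  · refine (hLx m).congr fun n => ?_
    congr 1
    refine Finset.sum_congr rfl fun i _ => ?_
    simp only [Set.indicator, hL, hG, Set.mem_inter_iff, Set.mem_ofPred_eq, hcx, hγx,
      Pi.one_apply]
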